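/- A \emph{normal map} (crossed module) is a group homomorphism $n\colon M\to G$ together with an action of $G$ on $M$ by automorphisms such that $n({}^g m)=g\,n(m)\,g^{-1}$ and ${}^{n(m)}m'=m\,m'\,m^{-1}$ for all $g\in G$, $m,m'\in M$. The \emph{free normal closure} of a homomorphism $\varphi\colon\Gamma\to G$ is the universal (initial) factorization $\Gamma\to\Gamma^{\varphi}\to G$ of $\varphi$ whose second map is normal. The \emph{normal closures tower} of $\varphi$ is $\cdots\to\Gamma_{i+1}\to\Gamma_i\to\cdots\to\Gamma_1=G$, where $\varphi_1=\varphi$ and $\Gamma\xrightarrow{\varphi_{i+1}}\Gamma_{i+1}\to\Gamma_i$ is the free normal closure of $\varphi_i\colon\Gamma\to\Gamma_i$; put $\Gamma_\infty=\varprojlim\Gamma_i$. For a group $X$ let $X^{(\infty)}$, $\gamma_\infty(X)$ and $Z_\infty(X)$ denote the last terms of the derived series, of the descending central series and of the ascending central series of $X$, when these series terminate. Let $\varphi\colon\Gamma\to G$ be a homomorphism of finite groups such that $G$ is perfect and $G$ is generated by the $G$-conjugates of $\varphi(\Gamma)$, that is, $G=\langle\varphi(\Gamma)^G\rangle$. Let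 $H=\Gamma_\infty$. Then the derived series and the ascending central series of $H$ terminate, the subgroup $H^{(\infty)}$ is perfect, and $H$ is the central product $H=H^{(\infty)}\circ Z_\infty(H)$, i.e. $H=H^{(\infty)}Z_\infty(H)$ and $[H^{(\infty)},Z_\infty(H)]=1$. Moreover, the descending central series of $\Gamma$ terminates, the groups $\Gamma/\gamma_\infty(\Gamma)$ and $Z_\infty(H)$ are nilpotent, and if $\Gamma/\gamma_\infty(\Gamma)$ has nilpotency class $c$, then $Z_\infty(H)$ has nilpotency class at most $c+1$. -/

import Mathlib

universe u v w

/-- A normal map (crossed module) `n : M →* G`, for a given action of `G` on `M` by automorphisms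
(written as a left action). -/
structure IsNormalMap {M : Type u} {G : Type v} [Group M] [Group G] [MulDistribMulAction G M]
    (n : M →* G) : Prop where
  map_smul : ∀ (g : G) (m : M), n (g • m) = g * n m * g⁻¹
  smul_eq_conj : ∀ m m' : M, n m • m' = m * m' * m⁻¹

namespace FreeNormalClosure

section Construction

variable {Γ : Type u} {G : Type v} [Group Γ] [Group G]

/-- The free product of copies `Γ_g` of `Γ`, one for each `g : G`. -/
abbrev Pre (Γ : Type u) (G : Type v) [Group Γ] [Group G] : Type (max u v) :=
  Monoid.CoprodI (fun _ : G => Γ)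

/-- The element `γ` of the copy of `Γ` indexed by `g`. -/
def gen (g : G) : Γ →* Pre Γ G := Monoid.CoprodI.of (M := fun _ : G => Γ) (i := g)

/-- `preMap φ` sends the element `γ` of the `g`-th copy of `Γ` to `g * φ γ * g⁻¹`. -/
def preMap (φ : Γ →* G) : Pre Γ G →* G :=
  Monoid.CoprodI.lift (fun g : G => (MulAut.conj g).toMonoidHom.comp φ)

/-- The action of `h : G` on the free product, taking the `g`-th copy of `Γ` to the `h * g`-th. -/
def preAct (Γ : Type u) {G : Type v} [Group Γ] [Group G] (h : G) : Pre Γ G →* Pre Γ G :=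
  Monoid.CoprodI.lift (fun g : G => gen (h * g))

@[simp] theorem preMap_gen (φ : Γ →* G) (g : G) (c : Γ) :
    preMap φ (gen g c) = g * φ c * g⁻¹ := by
  simp [preMap, gen]

@[simp] theorem preAct_gen (h g : G) (c : Γ) : preAct Γ h (gen g c) = gen (h * g) c := by
  simp [preAct, gen]

theorem pre_hom_ext {N : Type w} [Monoid N] {f f' : Pre Γ G →* N}
    (h : ∀ (g : G) (c : Γ), f (gen g c) = f' (gen g c)) : f = f' :=
  Monoid.CoprodI.ext_hom f f' fun g => MonoidHom.ext fun c => h g c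

theorem preAct_one (x : Pre Γ G) : preAct Γ (1 : G) x = x :=
  DFunLike.congr_fun (pre_hom_ext (f := preAct Γ (1 : G)) (f' := MonoidHom.id _)
    (fun g c => by simp)) x

theorem preAct_mul (h k : G) (x : Pre Γ G) :
    preAct Γ (h * k) x = preAct Γ h (preAct Γ k x) :=
  DFunLike.congr_fun (pre_hom_ext (f := preAct Γ (h * k))
    (f' := (preAct Γ h).comp (preAct Γ k)) (fun g c => by simp [mul_assoc])) x

theorem preMap_preAct (φ : Γ →* G) (h : G) (x : Pre Γ G) :
    preMap φ (preAct Γ h x) = h * preMap φ x * h⁻¹ :=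
  DFunLike.congr_fun (pre_hom_ext (f := (preMap φ).comp (preAct Γ h))
    (f' := (MulAut.conj h).toMonoidHom.comp (preMap φ)) (fun g c => by simp [mul_assoc])) x

/-- The Peiffer subgroup: the normal subgroup that enforces
`x * y * x⁻¹ = (preMap φ x) • y` for all `x`, `y`. -/
def peiffer (φ : Γ →* G) : Subgroup (Pre Γ G) :=
  Subgroup.normalClosure
    {z | ∃ x y : Pre Γ G, z = x * y * x⁻¹ * (preAct Γ (preMap φ x) y)⁻¹}

instance (φ : Γ →* G) : (peiffer φ).Normal := Subgroup.normalClosure_normal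

theorem peiffer_le_ker (φ : Γ →* G) : peiffer φ ≤ (preMap φ).ker := by
  refine Subgroup.normalClosure_le_normal ?_
  rintro z ⟨x, y, rfl⟩
  simp [MonoidHom.mem_ker, preMap_preAct, mul_assoc]

theorem peiffer_le_comap (φ : Γ →* G) (h : G) :
    peiffer φ ≤ (peiffer φ).comap (preAct Γ h) := by
  refine Subgroup.normalClosure_le_normal ?_
  rintro z ⟨x, y, rfl⟩
  refine Subgroup.subset_normalClosure ⟨preAct Γ h x, preAct Γ h y, ?_⟩
  simp [preMap_preAct, ← preAct_mul, mul_assoc]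

end Construction

end FreeNormalClosure

/-- The (free) normal closure `Γ^φ` of a homomorphism `φ : Γ →* G`. -/
def FreeNormalClosure {Γ : Type u} {G : Type v} [Group Γ] [Group G] (φ : Γ →* G) :
    Type (max u v) :=
  FreeNormalClosure.Pre Γ G ⧸ FreeNormalClosure.peiffer φ

namespace FreeNormalClosure

section Structure

variable {Γ : Type u} {G : Type v} [Group Γ] [Group G] (φ : Γ →* G)

instance : Group (FreeNormalClosure φ) :=
  inferInstanceAs (Group (Pre Γ G ⧸ peiffer φ))

/-- The quotient map from the free product. -/
def mk : Pre Γ G →* FreeNormalClosure φ := QuotientGroup.mk' (peiffer φ)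

theorem mk_surjective : Function.Surjective (mk φ) := QuotientGroup.mk'_surjective _

instance : MulDistribMulAction G (FreeNormalClosure φ) where
  smul h := QuotientGroup.map (peiffer φ) (peiffer φ) (preAct Γ h) (peiffer_le_comap φ h)
  one_smul x := by
    obtain ⟨x, rfl⟩ := mk_surjective φ x
    exact congrArg (mk φ) (preAct_one x)
  mul_smul h k x := by
    obtain ⟨x, rfl⟩ := mk_surjective φ x
    exact congrArg (mk φ) (preAct_mul h k x)
  smul_mul h x y :=
    map_mul (QuotientGroup.map (peiffer φ) (peiffer φ) (preAct Γ h) (peiffer_le_comap φ h)) x y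
  smul_one h :=
    map_one (QuotientGroup.map (peiffer φ) (peiffer φ) (preAct Γ h) (peiffer_le_comap φ h))

theorem smul_mk (h : G) (x : Pre Γ G) : h • mk φ x = mk φ (preAct Γ h x) := rfl

/-- The canonical map `c_φ : Γ →* Γ^φ`. -/
def unit : Γ →* FreeNormalClosure φ := (mk φ).comp (gen 1)

/-- The canonical normal map `Γ^φ →* G`. -/
def toBase : FreeNormalClosure φ →* G :=
  QuotientGroup.lift (peiffer φ) (preMap φ) (peiffer_le_ker φ)

theorem toBase_mk (x : Pre Γ G) : toBase φ (mk φ x) = preMap φ x := rfl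

theorem toBase_comp_unit : (toBase φ).comp (unit φ) = φ := by
  ext c
  simp [unit, toBase_mk]

theorem isNormalMap_toBase : IsNormalMap (toBase φ) where
  map_smul g m := by
    obtain ⟨x, rfl⟩ := mk_surjective φ m
    rw [smul_mk, toBase_mk, toBase_mk, preMap_preAct]
  smul_eq_conj m m' := by
    obtain ⟨x, rfl⟩ := mk_surjective φ m
    obtain ⟨y, rfl⟩ := mk_surjective φ m'
    rw [toBase_mk, smul_mk, ← map_inv, ← map_mul, ← map_mul, eq_comm, ← mul_inv_eq_one,
      ← map_inv, ← map_mul]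
    exact (QuotientGroup.eq_one_iff _).2 (Subgroup.subset_normalClosure ⟨x, y, rfl⟩)

/-- `Γ → Γ^φ → G` is the universal factorization of `φ` whose right map is normal: it maps by a
unique normal morphism to any other such factorization `Γ → M → G`. -/
theorem universal {M : Type w} [Group M] [MulDistribMulAction G M] (n : M →* G)
    (hn : IsNormalMap n) (ψ : Γ →* M) (hψ : n.comp ψ = φ) :
    ∃! f : FreeNormalClosure φ →* M,
      (∀ (g : G) (x : FreeNormalClosure φ), f (g • x) = g • f x) ∧
        n.comp f = toBase φ ∧ f.comp (unit φ) = ψ := by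
  let F : Pre Γ G →* M :=
    Monoid.CoprodI.lift (fun g : G => (MulDistribMulAction.toMonoidHom M g).comp ψ)
  have hF : ∀ (g : G) (c : Γ), F (gen g c) = g • ψ c := fun g c => by simp [F, gen]
  have hFs : ∀ (h : G) (x : Pre Γ G), F (preAct Γ h x) = h • F x := fun h x =>
    DFunLike.congr_fun (pre_hom_ext (f := F.comp (preAct Γ h))
      (f' := (MulDistribMulAction.toMonoidHom M h).comp F)
      (fun g c => by simp [hF, mul_smul])) x
  have hnF : ∀ x : Pre Γ G, n (F x) = preMap φ x := fun x =>
    DFunLike.congr_fun (pre_hom_ext (f := n.comp F) (f' := preMap φ)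
      (fun g c => by simp [hF, hn.map_smul, ← hψ])) x
  have hk : peiffer φ ≤ F.ker := by
    refine Subgroup.normalClosure_le_normal ?_
    rintro z ⟨x, y, rfl⟩
    simp only [SetLike.mem_coe, MonoidHom.mem_ker, map_mul, map_inv, hFs]
    rw [← hnF, hn.smul_eq_conj, mul_inv_cancel]
  refine ⟨QuotientGroup.lift (peiffer φ) F hk, ⟨?_, ?_, ?_⟩, ?_⟩
  · intro g x
    obtain ⟨x, rfl⟩ := mk_surjective φ x
    exact hFs g x
  · ext x
    obtain ⟨x, rfl⟩ := mk_surjective φ x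
    exact hnF x
  · ext c
    exact (hF 1 c).trans (one_smul _ _)
  · rintro f ⟨h1, -, h3⟩
    have : f.comp (mk φ) = F := pre_hom_ext fun g c => by
      have := preAct_gen g 1 c
      rw [mul_one] at this
      rw [hF, ← this, MonoidHom.comp_apply, ← smul_mk, h1, ← h3]
      rfl
    ext x
    obtain ⟨x, rfl⟩ := mk_surjective φ x
    exact DFunLike.congr_fun this x

end Structure

end FreeNormalClosure

/-- A group together with a homomorphism from `Γ`. -/
structure GroupUnder (Γ : Type u) [Group Γ] where
  carrier : Type u
  [group : Group carrier]
  hom : Γ →* carrier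

attribute [instance] GroupUnder.group

/-- The normal closures tower of `φ`. The indices start at `0`, so that `normalTower φ i` is
`Γ_{i+1}` with its map `φ_{i+1}` from `Γ`, in the indexing where `Γ_1 = G` and `φ_1 = φ`. -/
def normalTower {Γ G : Type u} [Group Γ] [Group G] (φ : Γ →* G) : ℕ → GroupUnder Γ
  | 0 => ⟨G, φ⟩
  | i + 1 => ⟨FreeNormalClosure (normalTower φ i).hom, FreeNormalClosure.unit (normalTower φ i).hom⟩

/-- The normal map from each member of the normal closures tower to the preceding one. -/
def normalTowerMap {Γ G : Type u} [Group Γ] [Group G] (φ : Γ →* G) (i : ℕ) :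
    (normalTower φ (i + 1)).carrier →* (normalTower φ i).carrier :=
  FreeNormalClosure.toBase (normalTower φ i).hom

/-- `Γ_∞`, the inverse limit of the normal closures tower of `φ`, as the group of compatible
sequences. -/
def normalTowerLimit {Γ G : Type u} [Group Γ] [Group G] (φ : Γ →* G) :
    Subgroup ((i : ℕ) → (normalTower φ i).carrier) where
  carrier := {x | ∀ i, normalTowerMap φ i (x (i + 1)) = x i}
  one_mem' i := by simp
  mul_mem' hx hy i := by simp [hx i, hy i]
  inv_mem' hx i := by simp [hx i]

/-- A series of subgroups terminates at `T`: all its members from some point on equal `T`. -/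
def TerminatesAt {H : Type u} [Group H] (S : ℕ → Subgroup H) (T : Subgroup H) : Prop :=
  ∃ t, ∀ n, t ≤ n → S n = T

/-- `H^(∞)`, the intersection (the last term, if there is one) of the derived series. -/
def perfectCore (H : Type u) [Group H] : Subgroup H := ⨅ n, derivedSeries H n

/-- `Z_∞(H)`, the union (the last term, if there is one) of the ascending central series. -/
def hypercenter (H : Type u) [Group H] : Subgroup H := ⨆ n, Subgroup.upperCentralSeries H n

/-- `γ_∞(H)`, the intersection (the last term, if there is one) of the descending central
series. -/
def gammaInfty (H : Type u) [Group H] : Subgroup H :=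
  ⨅ n, Subgroup.lowerCentralSeries (⊤ : Subgroup H) n

instance (H : Type u) [Group H] : (gammaInfty H).Normal :=
  Subgroup.normal_iInf_normal fun _ => inferInstance

/-- `H` is the (internal) central product of its subgroups `A` and `B`. -/
def IsCentralProduct {H : Type u} [Group H] (A B : Subgroup H) : Prop :=
  A ⊔ B = ⊤ ∧ ∀ a ∈ A, ∀ b ∈ B, a * b = b * a

/-!
Each map `Γ_{i+1} → Γ_i` of the tower is a normal map, so its kernel is central, and it is
surjective because `Γ` normally generates `Γ_i`. Hence `Γ_i` is a hypercentral extension of the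
perfect group `G`, and if it is finite it is the product of its perfect core and its hypercenter.
The quotient by the perfect core is then nilpotent; in a nilpotent group a normally generating
subgroup is the whole group, so this quotient is an image of `Γ / γ_∞(Γ)`. The perfect core
centralizes the hypercenter (three subgroups lemma), so it is a perfect central extension of a
subgroup of `G`, and Schur's theorem bounds its order. The orders of the `Γ_i` are therefore
bounded, the tower stabilizes and `Γ_∞` is one of the `Γ_i`. Its hypercenter is a central extension
of its image modulo the perfect core, that is, of a quotient of `Γ / γ_∞(Γ)`: this is where `c + 1`
comes from.
-/

open Subgroup
open scoped commutatorElement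

section Series

theorem exists_forall_le_eq_of_monotone_of_bddAbove {a : ℕ → ℕ} (ha : Monotone a)
    (hb : BddAbove (Set.range a)) : ∃ t, ∀ i, t ≤ i → a i = a t := by
  obtain ⟨t, ht⟩ := Nat.sSup_mem (Set.range_nonempty a) hb
  exact ⟨t, fun i hi => le_antisymm (ht ▸ le_csSup hb ⟨i, rfl⟩) (ha hi)⟩

variable {H : Type u} [Group H]

theorem TerminatesAt.of_antitone {S : ℕ → Subgroup H} {T : Subgroup H} [T.FiniteIndex]
    (hS : Antitone S) (hT : T = ⨅ n, S n) : TerminatesAt S T := by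
  have hle (n : ℕ) : T ≤ S n := hT.trans_le (iInf_le S n)
  have hfin (n : ℕ) : (S n).FiniteIndex := finiteIndex_of_le (hle n)
  obtain ⟨t, ht⟩ := exists_forall_le_eq_of_monotone_of_bddAbove
    (a := fun n => (S n).index) (fun _ _ hmn => index_antitone (hS hmn))
    ⟨T.index, Set.forall_mem_range.2 fun n => index_antitone (hle n)⟩
  have hconst (n : ℕ) (hn : t ≤ n) : S n = S t :=
    (hS hn).eq_of_not_lt fun hlt => (index_strictAnti hlt).ne' (ht n hn)
  refine ⟨t, fun n hn => le_antisymm (hT ▸ le_iInf fun m => ?_) (hle n)⟩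
  rw [hconst n hn, ← hconst (max t m) (le_max_left t m)]
  exact hS (le_max_right t m)

theorem TerminatesAt.of_monotone [WellFoundedGT (Subgroup H)] {S : ℕ → Subgroup H}
    {T : Subgroup H} (hS : Monotone S) (hT : T = ⨆ n, S n) : TerminatesAt S T := by
  obtain ⟨t, ht⟩ := WellFoundedGT.monotone_chain_condition ⟨S, hS⟩
  have hconst : ∀ n, t ≤ n → S t = S n := ht
  refine ⟨t, fun n hn => le_antisymm (hT ▸ le_iSup S n) (hT ▸ iSup_le fun m => ?_)⟩
  rw [← hconst n hn, hconst (max t m) (le_max_left t m)]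
  exact hS (le_max_right t m)

theorem isNilpotent_quotient_gammaInfty
    (h : TerminatesAt (Subgroup.lowerCentralSeries (⊤ : Subgroup H)) (gammaInfty H)) :
    Group.IsNilpotent (H ⧸ gammaInfty H) := by
  obtain ⟨t, ht⟩ := h
  refine Subgroup.nilpotent_iff_lowerCentralSeries.2 ⟨t, ?_⟩
  rw [← map_top_of_surjective _ (QuotientGroup.mk'_surjective (gammaInfty H)),
    ← map_lowerCentralSeries, ht t le_rfl, QuotientGroup.map_mk'_self]

theorem gammaInfty_le_ker {N : Type v} [Group N] [Group.IsNilpotent N] (f : H →* N) :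
    gammaInfty H ≤ f.ker := by
  obtain ⟨n, hn⟩ := Subgroup.nilpotent_iff_lowerCentralSeries.1 ‹Group.IsNilpotent N›
  refine (iInf_le _ n).trans ?_
  rw [← MonoidHom.comap_bot, ← map_le_iff_le_comap, map_lowerCentralSeries, ← hn]
  exact lowerCentralSeries_mono n le_top

instance perfectCore_normal : (perfectCore H).Normal :=
  normal_iInf_normal fun n => derivedSeries_normal H n

theorem isPerfect_perfectCore (h : TerminatesAt (derivedSeries H) (perfectCore H)) :
    Group.IsPerfect (perfectCore H) := by
  obtain ⟨t, ht⟩ := h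
  have hsucc : derivedSeries H (t + 1) = perfectCore H := ht (t + 1) t.le_succ
  rwa [derivedSeries_succ, ht t le_rfl, ← Subgroup.isPerfect_iff] at hsucc

theorem perfectCore_sup_ker {G : Type v} [Group G] [Group.IsPerfect G]
    (h : TerminatesAt (derivedSeries H) (perfectCore H)) {p : H →* G}
    (hp : Function.Surjective p) : perfectCore H ⊔ p.ker = ⊤ := by
  obtain ⟨t, ht⟩ := h
  rw [← ht t le_rfl, ← comap_map_eq, map_derivedSeries_eq hp,
    Group.IsPerfect.derivedSeries_eq_top, comap_top]

end Series

section Hypercenter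

variable {H : Type u} [Group H]

theorem commutator_upperCentralSeries_eq_bot (P : Subgroup H) [Group.IsPerfect P] (n : ℕ) :
    ⁅P, Subgroup.upperCentralSeries H n⁆ = ⊥ := by
  induction n with
  | zero => rw [Subgroup.upperCentralSeries_zero, commutator_bot_right]
  | succ n ih =>
    have hle : ⁅Subgroup.upperCentralSeries H (n + 1), P⁆ ≤ Subgroup.upperCentralSeries H n :=
      (commutator_mono le_rfl le_top).trans (commutator_upperCentralSeries_top_le H n)
    have hbot : ⁅⁅Subgroup.upperCentralSeries H (n + 1), P⁆, P⁆ = ⊥ := by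
      rw [eq_bot_iff, ← ih, commutator_comm P]
      exact commutator_mono hle le_rfl
    have hrot : ⁅⁅P, Subgroup.upperCentralSeries H (n + 1)⁆, P⁆ = ⊥ := by
      rwa [commutator_comm P]
    -- The three subgroups lemma gives `⁅⁅P, P⁆, Z_{n+1}⁆ = ⊥`, and `⁅P, P⁆ = P`.
    simpa only [commutator_eq_self] using commutator_commutator_eq_bot_of_rotate hrot hbot

theorem hypercenter_le_centralizer (P : Subgroup H) [Group.IsPerfect P] :
    hypercenter H ≤ centralizer (P : Set H) :=
  iSup_le fun n => le_centralizer_iff.1 <|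
    commutator_eq_bot_iff_le_centralizer.1 (commutator_upperCentralSeries_eq_bot P n)

theorem comap_upperCentralSeries_le_succ {G : Type v} [Group G] {f : H →* G}
    (hf : f.ker ≤ center H) (n : ℕ) :
    (Subgroup.upperCentralSeries G n).comap f ≤ Subgroup.upperCentralSeries H (n + 1) := by
  induction n with
  | zero => simpa only [Subgroup.upperCentralSeries_zero, MonoidHom.comap_bot, zero_add,
      Subgroup.upperCentralSeries_one] using hf
  | succ n ih =>
    intro x hx
    refine Subgroup.mem_upperCentralSeries_succ_iff.2 fun y => ih ?_
    simpa only [mem_comap, map_commutatorElement] using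
      Subgroup.mem_upperCentralSeries_succ_iff.1 (mem_comap.1 hx) (f y)

theorem comap_hypercenter_le {G : Type v} [Group G] {f : H →* G} (hf : f.ker ≤ center H) :
    (hypercenter G).comap f ≤ hypercenter H := by
  intro x hx
  obtain ⟨n, hn⟩ := (mem_iSup_of_directed (Subgroup.upperCentralSeries_mono G).directed_le).1 hx
  exact le_iSup (Subgroup.upperCentralSeries H) (n + 1) (comap_upperCentralSeries_le_succ hf n hn)

theorem ker_comp_le_hypercenter {E : Type v} {G : Type w} [Group E] [Group G] {p : E →* G}
    (hp : p.ker ≤ hypercenter E) {f : H →* E} (hf : f.ker ≤ center H) :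
    (p.comp f).ker ≤ hypercenter H := by
  rw [← MonoidHom.comap_ker]
  exact (comap_mono hp).trans (comap_hypercenter_le hf)

theorem perfectCore_sup_hypercenter {G : Type v} [Group G] [Group.IsPerfect G]
    (h : TerminatesAt (derivedSeries H) (perfectCore H)) {p : H →* G}
    (hp : Function.Surjective p) (hker : p.ker ≤ hypercenter H) :
    perfectCore H ⊔ hypercenter H = ⊤ :=
  eq_top_mono (sup_le_sup_left hker _) (perfectCore_sup_ker h hp)

theorem ker_comp_subtype_le_center {G : Type v} [Group G] {p : H →* G}
    (hker : p.ker ≤ hypercenter H) (P : Subgroup H) [Group.IsPerfect P] :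
    (p.comp P.subtype).ker ≤ center P := by
  intro x hx
  rw [← MonoidHom.comap_ker, mem_comap] at hx
  exact mem_center_iff.2 fun y => Subtype.ext <|
    mem_centralizer_iff.1 (hypercenter_le_centralizer P (hker hx)) y y.2

theorem isNilpotent_quotient_of_sup_hypercenter_eq_top {N : Subgroup H} [N.Normal]
    (hZ : TerminatesAt (Subgroup.upperCentralSeries H) (hypercenter H))
    (hN : N ⊔ hypercenter H = ⊤) : Group.IsNilpotent (H ⧸ N) := by
  obtain ⟨t, ht⟩ := hZ
  have hsurj := QuotientGroup.mk'_surjective N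
  refine ⟨t, eq_top_iff.2 (le_trans ?_ (Subgroup.upperCentralSeries.map hsurj t))⟩
  rw [← map_top_of_surjective _ hsurj, ← hN, Subgroup.map_sup, QuotientGroup.map_mk'_self,
    bot_sup_eq, ht t le_rfl]

end Hypercenter

namespace IsCentralProduct

variable {H : Type u} [Group H]

theorem perfectCore_hypercenter [Group.IsPerfect (perfectCore H)]
    (h : perfectCore H ⊔ hypercenter H = ⊤) :
    IsCentralProduct (perfectCore H) (hypercenter H) :=
  ⟨h, fun a ha _ hb => mem_centralizer_iff.1 (hypercenter_le_centralizer _ hb) a ha⟩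

variable {A B : Subgroup H} [A.Normal]

theorem ker_mk'_comp_subtype_le_center (h : IsCentralProduct A B) :
    ((QuotientGroup.mk' A).comp B.subtype).ker ≤ center B := by
  intro x hx
  rw [← MonoidHom.comap_ker, QuotientGroup.ker_mk', mem_comap] at hx
  exact mem_center_iff.2 fun y => Subtype.ext (h.2 x hx y y.2).symm

theorem isNilpotent_right [Group.IsNilpotent (H ⧸ A)] (h : IsCentralProduct A B) :
    Group.IsNilpotent B :=
  Subgroup.isNilpotent_of_ker_le_center _ h.ker_mk'_comp_subtype_le_center

theorem nilpotencyClass_right_le [Group.IsNilpotent (H ⧸ A)] (h : IsCentralProduct A B) :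
    Group.nilpotencyClass B ≤ Group.nilpotencyClass (H ⧸ A) + 1 :=
  Group.nilpotencyClass_le_of_ker_le_center _ h.ker_mk'_comp_subtype_le_center

end IsCentralProduct

section NormalGeneration

variable {Γ : Type u} {E : Type v} [Group Γ] [Group E]

theorem normalClosure_range_comp_eq_top {F : Type w} [Group F] {ψ : Γ →* E}
    (hψ : normalClosure (Set.range ψ) = ⊤) {f : E →* F} (hf : Function.Surjective f) :
    normalClosure (Set.range (f.comp ψ)) = ⊤ := by
  rw [MonoidHom.coe_comp, Set.range_comp, ← map_normalClosure _ f hf, hψ,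
    map_top_of_surjective f hf]

theorem normal_sup_upperCentralSeries {K : Subgroup E} {n : ℕ}
    (h : K ⊔ Subgroup.upperCentralSeries E (n + 1) = ⊤) :
    (K ⊔ Subgroup.upperCentralSeries E n).Normal := by
  rw [← normalizer_eq_top_iff, eq_top_iff, ← h, sup_le_iff]
  refine ⟨le_sup_left.trans le_normalizer, le_normalizer_iff_commutator_le_right.2 ?_⟩
  exact (commutator_mono le_rfl le_top).trans <|
    (commutator_upperCentralSeries_top_le E n).trans le_sup_right

theorem eq_top_of_normalClosure_eq_top [Group.IsNilpotent E] {K : Subgroup E}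
    (hK : normalClosure (K : Set E) = ⊤) : K = ⊤ := by
  obtain ⟨n, hn⟩ := Group.IsNilpotent.nilpotent E
  have hsup (m : ℕ) : K ⊔ Subgroup.upperCentralSeries E m = ⊤ → K = ⊤ := by
    induction m with
    | zero => exact fun h => by rwa [Subgroup.upperCentralSeries_zero, sup_bot_eq] at h
    | succ m ih =>
      intro h
      have := normal_sup_upperCentralSeries h
      exact ih (eq_top_iff.2 (hK ▸ normalClosure_le_normal (SetLike.coe_subset_coe.2 le_sup_left)))
  exact hsup n (by rw [hn, sup_top_eq])

theorem surjective_of_normalClosure_range_eq_top [Group.IsNilpotent E] {ψ : Γ →* E}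
    (hψ : normalClosure (Set.range ψ) = ⊤) : Function.Surjective ψ :=
  MonoidHom.range_eq_top.1 (eq_top_of_normalClosure_eq_top (by rwa [MonoidHom.coe_range]))

theorem exists_surjective_quotient_gammaInfty [Group.IsNilpotent E] {ψ : Γ →* E}
    (hψ : normalClosure (Set.range ψ) = ⊤) :
    ∃ f : Γ ⧸ gammaInfty Γ →* E, Function.Surjective f :=
  ⟨QuotientGroup.lift _ ψ (gammaInfty_le_ker ψ), QuotientGroup.lift_surjective_of_surjective _ _
    (surjective_of_normalClosure_range_eq_top hψ) _⟩

end NormalGeneration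

section CentralExtensions

variable {E : Type u} [Group E]

theorem commutatorElement_mul_left_of_mem_center {z : E} (hz : z ∈ center E) (a b : E) :
    ⁅a * z, b⁆ = ⁅a, b⁆ := by
  have hzb : ⁅z, b⁆ = 1 := commutatorElement_eq_one_iff_mul_comm.2 (mem_center_iff.1 hz b).symm
  rw [commutatorElement_mul_left_eq_conj_mul, hzb, mul_one, mul_inv_cancel, one_mul]

theorem commutatorElement_mul_mul_of_mem_center {z w : E} (hz : z ∈ center E)
    (hw : w ∈ center E) (a b : E) : ⁅a * z, b * w⁆ = ⁅a, b⁆ := by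
  rw [commutatorElement_mul_left_of_mem_center hz, ← commutatorElement_inv,
    commutatorElement_mul_left_of_mem_center hw, commutatorElement_inv]

theorem commutatorSet_subset_range_out :
    commutatorSet E ⊆ Set.range fun x : (E ⧸ center E) × (E ⧸ center E) => ⁅x.1.out, x.2.out⁆ := by
  rintro _ ⟨a, b, rfl⟩
  obtain ⟨z, hz⟩ := QuotientGroup.mk_out_eq_mul (center E) a
  obtain ⟨w, hw⟩ := QuotientGroup.mk_out_eq_mul (center E) b
  exact ⟨(a, b), by simp only [hz, hw, commutatorElement_mul_mul_of_mem_center z.2 w.2]⟩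

instance finite_commutatorSet [(center E).FiniteIndex] : Finite (commutatorSet E) :=
  Finite.Set.subset _ commutatorSet_subset_range_out

theorem card_commutatorSet_le [(center E).FiniteIndex] :
    Nat.card (commutatorSet E) ≤ (center E).index ^ 2 :=
  calc Nat.card (commutatorSet E)
      ≤ Nat.card (Set.range fun x : (E ⧸ center E) × (E ⧸ center E) => ⁅x.1.out, x.2.out⁆) :=
        Nat.card_mono (Set.toFinite _) commutatorSet_subset_range_out
    _ ≤ Nat.card ((E ⧸ center E) × (E ⧸ center E)) := Finite.card_range_le _
    _ = (center E).index ^ 2 := by rw [Nat.card_prod, ← sq, index_eq_card]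

theorem card_commutator_le [(center E).FiniteIndex] :
    Nat.card (_root_.commutator E) ≤ (center E).index ^ ((center E).index ^ 3 + 1) := by
  have hpos : 0 < (center E).index := Nat.pos_of_ne_zero FiniteIndex.index_ne_zero
  refine (Nat.le_of_dvd (pow_pos hpos _) (card_commutator_dvd_index_center_pow E)).trans
    (Nat.pow_le_pow_right hpos ?_)
  rw [pow_succ' _ 2]
  gcongr
  exact card_commutatorSet_le

theorem finite_of_finiteIndex_center [(center E).FiniteIndex] [Finite (Abelianization E)] :
    Finite E :=
  have : (_root_.commutator E).FiniteIndex :=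
    finiteIndex_iff_finite_quotient.2 ‹Finite (Abelianization E)›
  (finite_iff_finite_and_finiteIndex (H := _root_.commutator E)).2 ⟨inferInstance, this⟩

variable {G : Type v} [Group G] [Finite G] {f : E →* G}

theorem finiteIndex_center_of_ker_le_center (hf : f.ker ≤ center E) : (center E).FiniteIndex :=
  finiteIndex_of_le hf

theorem index_center_le_card (hf : f.ker ≤ center E) : (center E).index ≤ Nat.card G :=
  calc (center E).index ≤ f.ker.index := index_antitone hf
    _ = Nat.card f.range := index_ker f
    _ ≤ Nat.card G := card_le_card_group f.range

theorem card_le_of_isPerfect_of_ker_le_center [Group.IsPerfect E] (hf : f.ker ≤ center E) :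
    Nat.card E ≤ Nat.card G ^ (Nat.card G ^ 3 + 1) := by
  have := finiteIndex_center_of_ker_le_center hf
  have hE : Nat.card E = Nat.card (_root_.commutator E) := by
    rw [Group.IsPerfect.commutator_eq_top, card_top]
  have hindex : (center E).index ≤ Nat.card G := index_center_le_card hf
  exact hE.trans_le <| card_commutator_le.trans <|
    pow_le_pow hindex Nat.card_pos (Nat.succ_le_succ (Nat.pow_le_pow_left hindex 3))

variable {Γ : Type w} [Group Γ] [(gammaInfty Γ).FiniteIndex] {ψ : Γ →* E}

theorem finite_of_ker_le_center (hψ : normalClosure (Set.range ψ) = ⊤) (hf : f.ker ≤ center E) :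
    Finite E := by
  have := finiteIndex_center_of_ker_le_center hf
  obtain ⟨g, hg⟩ := exists_surjective_quotient_gammaInfty
    (normalClosure_range_comp_eq_top hψ (f := (Abelianization.of : E →* Abelianization E))
      (QuotientGroup.mk'_surjective _))
  have : Finite (Abelianization E) := Finite.of_surjective g hg
  exact finite_of_finiteIndex_center

theorem card_le_of_ker_le_hypercenter [Finite E] [Group.IsPerfect G]
    (hψ : normalClosure (Set.range ψ) = ⊤) {p : E →* G} (hp : Function.Surjective p)
    (hker : p.ker ≤ hypercenter E) :
    Nat.card E ≤ Nat.card (Γ ⧸ gammaInfty Γ) * Nat.card G ^ (Nat.card G ^ 3 + 1) := by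
  have hcore : TerminatesAt (derivedSeries E) (perfectCore E) :=
    .of_antitone (derivedSeries_antitone E) rfl
  have := isPerfect_perfectCore hcore
  have := isNilpotent_quotient_of_sup_hypercenter_eq_top
    (.of_monotone (Subgroup.upperCentralSeries_mono E) rfl)
    (perfectCore_sup_hypercenter hcore hp hker)
  obtain ⟨q, hq⟩ := exists_surjective_quotient_gammaInfty
    (normalClosure_range_comp_eq_top hψ (QuotientGroup.mk'_surjective (perfectCore E)))
  rw [card_eq_card_quotient_mul_card_subgroup (perfectCore E)]
  exact Nat.mul_le_mul (Nat.card_le_card_of_surjective q hq)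
    (card_le_of_isPerfect_of_ker_le_center (ker_comp_subtype_le_center hker _))

end CentralExtensions

theorem IsNormalMap.ker_le_center {M : Type u} {G : Type v} [Group M] [Group G]
    [MulDistribMulAction G M] {n : M →* G} (hn : IsNormalMap n) : n.ker ≤ center M := by
  intro x hx
  refine mem_center_iff.2 fun y => ?_
  have hxy : y = x * y * x⁻¹ := by
    simpa only [MonoidHom.mem_ker.1 hx, one_smul] using hn.smul_eq_conj x y
  exact eq_mul_inv_iff_mul_eq.1 hxy

namespace FreeNormalClosure

variable {Γ : Type u} {G : Type v} [Group Γ] [Group G] {φ : Γ →* G}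

theorem normalClosure_range_le_range_toBase : normalClosure (Set.range φ) ≤ (toBase φ).range := by
  rw [normalClosure, closure_le]
  intro x hx
  obtain ⟨_, ⟨c, rfl⟩, hx⟩ := Group.mem_conjugatesOfSet_iff.1 hx
  obtain ⟨g, rfl⟩ := isConj_iff.1 hx
  exact ⟨mk φ (gen g c), by rw [toBase_mk, preMap_gen]⟩

theorem toBase_surjective (hφ : normalClosure (Set.range φ) = ⊤) :
    Function.Surjective (toBase φ) :=
  MonoidHom.range_eq_top.1 (eq_top_mono normalClosure_range_le_range_toBase hφ)

theorem mk_gen_toBase (x : FreeNormalClosure φ) (c : Γ) :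
    mk φ (gen (toBase φ x) c) = x * unit φ c * x⁻¹ := by
  rw [← (isNormalMap_toBase φ).smul_eq_conj, unit, MonoidHom.comp_apply, smul_mk, preAct_gen,
    mul_one]

theorem normalClosure_range_unit (hφ : normalClosure (Set.range φ) = ⊤) :
    normalClosure (Set.range (unit φ)) = ⊤ := by
  set N := normalClosure (Set.range (unit φ))
  have hgen (g : G) (c : Γ) : mk φ (gen g c) ∈ N := by
    obtain ⟨x, rfl⟩ := toBase_surjective hφ g
    rw [mk_gen_toBase]
    exact normalClosure_normal.conj_mem _ (subset_normalClosure (Set.mem_range_self c)) x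
  have hmk : (QuotientGroup.mk' N).comp (mk φ) = 1 :=
    pre_hom_ext fun g c => (QuotientGroup.eq_one_iff _).2 (hgen g c)
  refine eq_top_iff.2 fun x _ => ?_
  obtain ⟨x, rfl⟩ := mk_surjective φ x
  exact (QuotientGroup.eq_one_iff _).1 (DFunLike.congr_fun hmk x)

end FreeNormalClosure

section InverseSequence

theorem exists_compatible_sequence {X : ℕ → Type u} {f : ∀ i, X (i + 1) → X i}
    (hf : ∀ i, Function.Surjective (f i)) (t : ℕ) (y : X t) :
    ∃ x : ∀ i, X i, (∀ i, f i (x (i + 1)) = x i) ∧ x t = y := by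
  induction t generalizing X f with
  | zero =>
    choose s hs using hf
    exact ⟨fun i => Nat.rec y s i, fun i => hs i _, rfl⟩
  | succ t ih =>
    obtain ⟨x, hx, hxt⟩ := ih (X := fun i => X (i + 1)) (fun i => hf (i + 1)) y
    exact ⟨Nat.rec (f 0 (x 0)) fun i _ => x i, Nat.rec rfl fun i _ => hx i, hxt⟩

theorem compatible_sequence_ext {X : ℕ → Type u} {f : ∀ i, X (i + 1) → X i} {t : ℕ}
    (hf : ∀ i, t ≤ i → Function.Injective (f i)) {x y : ∀ i, X i}
    (hx : ∀ i, f i (x (i + 1)) = x i) (hy : ∀ i, f i (y (i + 1)) = y i) (hxy : x t = y t) :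
    x = y := by
  induction t generalizing X f with
  | zero =>
    funext i
    induction i with
    | zero => exact hxy
    | succ i ih => exact hf i i.zero_le (by rw [hx, hy, ih])
  | succ t ih =>
    have hshift : (fun i => x (i + 1)) = fun i => y (i + 1) :=
      ih (fun i hi => hf (i + 1) (Nat.succ_le_succ hi)) (fun i => hx (i + 1))
        (fun i => hy (i + 1)) hxy
    funext i
    rw [← hx, ← hy, congrFun hshift i]

end InverseSequence

section NormalTower

variable {Γ G : Type u} [Group Γ] [Group G] {φ : Γ →* G}

/-- The composite `Γ_{i+1} → ⋯ → Γ_1 = G` of the maps of the normal closures tower, indexed like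
`normalTower`. -/
def normalTowerToBase (φ : Γ →* G) : ∀ i, (normalTower φ i).carrier →* G
  | 0 => MonoidHom.id G
  | i + 1 => (normalTowerToBase φ i).comp (normalTowerMap φ i)

theorem normalClosure_range_normalTower_hom (hφ : normalClosure (Set.range φ) = ⊤) :
    ∀ i, normalClosure (Set.range (normalTower φ i).hom) = ⊤
  | 0 => hφ
  | i + 1 => FreeNormalClosure.normalClosure_range_unit (normalClosure_range_normalTower_hom hφ i)

theorem normalTowerMap_surjective (hφ : normalClosure (Set.range φ) = ⊤) (i : ℕ) :
    Function.Surjective (normalTowerMap φ i) :=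
  FreeNormalClosure.toBase_surjective (normalClosure_range_normalTower_hom hφ i)

theorem ker_normalTowerMap_le_center (i : ℕ) :
    (normalTowerMap φ i).ker ≤ center (normalTower φ (i + 1)).carrier :=
  (FreeNormalClosure.isNormalMap_toBase _).ker_le_center

theorem normalTowerToBase_surjective (hφ : normalClosure (Set.range φ) = ⊤) :
    ∀ i, Function.Surjective (normalTowerToBase φ i)
  | 0 => Function.surjective_id
  | i + 1 => (normalTowerToBase_surjective hφ i).comp (normalTowerMap_surjective hφ i)

theorem ker_normalTowerToBase_le_hypercenter :
    ∀ i, (normalTowerToBase φ i).ker ≤ hypercenter (normalTower φ i).carrier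
  | 0 => MonoidHom.ker_id.trans_le bot_le
  | i + 1 => ker_comp_le_hypercenter (ker_normalTowerToBase_le_hypercenter i)
      (ker_normalTowerMap_le_center i)

variable [(gammaInfty Γ).FiniteIndex] [Finite G]

theorem finite_normalTower (hφ : normalClosure (Set.range φ) = ⊤) :
    ∀ i, Finite (normalTower φ i).carrier
  | 0 => ‹Finite G›
  | i + 1 =>
    have := finite_normalTower hφ i
    finite_of_ker_le_center (normalClosure_range_normalTower_hom hφ (i + 1))
      (ker_normalTowerMap_le_center i)

theorem exists_normalTowerMap_bijective [Group.IsPerfect G]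
    (hφ : normalClosure (Set.range φ) = ⊤) :
    ∃ t, ∀ i, t ≤ i → Function.Bijective (normalTowerMap φ i) := by
  have hsurj := normalTowerMap_surjective hφ
  have hfin := finite_normalTower hφ
  have hmono : Monotone fun i => Nat.card (normalTower φ i).carrier :=
    monotone_nat_of_le_succ fun i => Nat.card_le_card_of_surjective _ (hsurj i)
  have hbdd : BddAbove (Set.range fun i => Nat.card (normalTower φ i).carrier) :=
    ⟨_, Set.forall_mem_range.2 fun i => card_le_of_ker_le_hypercenter
      (normalClosure_range_normalTower_hom hφ i) (normalTowerToBase_surjective hφ i)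
      (ker_normalTowerToBase_le_hypercenter i)⟩
  obtain ⟨t, ht⟩ := exists_forall_le_eq_of_monotone_of_bddAbove hmono hbdd
  exact ⟨t, fun i hi => (Nat.bijective_iff_surjective_and_card _).2
    ⟨hsurj i, (ht (i + 1) (hi.trans i.le_succ)).trans (ht i hi).symm⟩⟩

end NormalTower

section NormalTowerLimit

variable {Γ G : Type u} [Group Γ] [Group G]

/-- The canonical homomorphism `Γ → Γ_∞`, whose components are the maps of `Γ` to the members of the
tower. -/
def normalTowerLimitHom (φ : Γ →* G) : Γ →* normalTowerLimit φ :=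
  (MonoidHom.pi fun i => (normalTower φ i).hom).codRestrict (normalTowerLimit φ) fun c i =>
    DFunLike.congr_fun (FreeNormalClosure.toBase_comp_unit (normalTower φ i).hom) c

/-- The projection `Γ_∞ → Γ_{i+1}` of the limit to a member of the normal closures tower, indexed
like `normalTower`. -/
def normalTowerLimitProj (φ : Γ →* G) (i : ℕ) :
    normalTowerLimit φ →* (normalTower φ i).carrier :=
  (Pi.evalMonoidHom _ i).comp (normalTowerLimit φ).subtype

variable {φ : Γ →* G}

theorem normalTowerLimitProj_bijective (hφ : normalClosure (Set.range φ) = ⊤) {t : ℕ}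
    (ht : ∀ i, t ≤ i → Function.Bijective (normalTowerMap φ i)) :
    Function.Bijective (normalTowerLimitProj φ t) := by
  refine ⟨fun x y hxy => Subtype.ext ?_, fun y => ?_⟩
  · exact compatible_sequence_ext (fun i hi => (ht i hi).injective) x.2 y.2 hxy
  · obtain ⟨x, hx, hxt⟩ := exists_compatible_sequence (normalTowerMap_surjective hφ) t y
    exact ⟨⟨x, hx⟩, hxt⟩

theorem normalClosure_range_normalTowerLimitHom (hφ : normalClosure (Set.range φ) = ⊤) {t : ℕ}
    (ht : Function.Bijective (normalTowerLimitProj φ t)) :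
    normalClosure (Set.range (normalTowerLimitHom φ)) = ⊤ := by
  let e := MulEquiv.ofBijective (normalTowerLimitProj φ t) ht
  have he : e.symm.toMonoidHom.comp (normalTower φ t).hom = normalTowerLimitHom φ :=
    MonoidHom.ext fun c => e.symm_apply_eq.2 rfl
  rw [← he]
  exact normalClosure_range_comp_eq_top (normalClosure_range_normalTower_hom hφ t)
    e.symm.surjective

theorem ker_normalTowerToBase_comp_proj_le_hypercenter {t : ℕ}
    (ht : Function.Injective (normalTowerLimitProj φ t)) :
    ((normalTowerToBase φ t).comp (normalTowerLimitProj φ t)).ker ≤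
      hypercenter (normalTowerLimit φ) :=
  ker_comp_le_hypercenter (ker_normalTowerToBase_le_hypercenter t)
    (((MonoidHom.ker_eq_bot_iff _).2 ht).trans_le bot_le)

theorem perfectCore_sup_hypercenter_normalTowerLimit [Finite (normalTowerLimit φ)]
    [Group.IsPerfect G] (hφ : normalClosure (Set.range φ) = ⊤) {t : ℕ}
    (ht : Function.Bijective (normalTowerLimitProj φ t)) :
    perfectCore (normalTowerLimit φ) ⊔ hypercenter (normalTowerLimit φ) = ⊤ :=
  perfectCore_sup_hypercenter (.of_antitone (derivedSeries_antitone _) rfl)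
    ((normalTowerToBase_surjective hφ t).comp ht.surjective)
    (ker_normalTowerToBase_comp_proj_le_hypercenter ht.injective)

end NormalTowerLimit

theorem mainTheorem8_general {Γ G : Type u} [Group Γ] [Group G] [(gammaInfty Γ).FiniteIndex]
    [Finite G] (φ : Γ →* G) (hperf : Group.IsPerfect G)
    (hgen : Subgroup.normalClosure (Set.range φ) = ⊤) :
    TerminatesAt (derivedSeries (normalTowerLimit φ)) (perfectCore (normalTowerLimit φ)) ∧
    TerminatesAt (Subgroup.upperCentralSeries (normalTowerLimit φ))
      (hypercenter (normalTowerLimit φ)) ∧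
    TerminatesAt (Subgroup.lowerCentralSeries (⊤ : Subgroup Γ)) (gammaInfty Γ) ∧
    Group.IsPerfect (perfectCore (normalTowerLimit φ)) ∧
    IsCentralProduct (perfectCore (normalTowerLimit φ)) (hypercenter (normalTowerLimit φ)) ∧
    Group.IsNilpotent (Γ ⧸ gammaInfty Γ) ∧
    Group.IsNilpotent (hypercenter (normalTowerLimit φ)) ∧
    ∀ c : ℕ, Group.nilpotencyClass (Γ ⧸ gammaInfty Γ) = c →
      Group.nilpotencyClass (hypercenter (normalTowerLimit φ)) ≤ c + 1 := by
  obtain ⟨t, ht⟩ := exists_normalTowerMap_bijective hgen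
  have hproj := normalTowerLimitProj_bijective hgen ht
  have := finite_normalTower hgen t
  have : Finite (normalTowerLimit φ) := .of_injective _ hproj.injective
  have hD : TerminatesAt (derivedSeries (normalTowerLimit φ)) _ :=
    .of_antitone (derivedSeries_antitone _) rfl
  have hZ : TerminatesAt (Subgroup.upperCentralSeries (normalTowerLimit φ)) _ :=
    .of_monotone (Subgroup.upperCentralSeries_mono _) rfl
  have hγ : TerminatesAt (Subgroup.lowerCentralSeries (⊤ : Subgroup Γ)) (gammaInfty Γ) :=
    .of_antitone (Subgroup.lowerCentralSeries_antitone _) rfl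
  have hcore := isPerfect_perfectCore hD
  have hsup := perfectCore_sup_hypercenter_normalTowerLimit hgen hproj
  have hprod := IsCentralProduct.perfectCore_hypercenter hsup
  have hnilΓ := isNilpotent_quotient_gammaInfty hγ
  have hnil := isNilpotent_quotient_of_sup_hypercenter_eq_top hZ hsup
  refine ⟨hD, hZ, hγ, hcore, hprod, hnilΓ, hprod.isNilpotent_right, ?_⟩
  rintro c rfl
  obtain ⟨q, hq⟩ := exists_surjective_quotient_gammaInfty
    (normalClosure_range_comp_eq_top (normalClosure_range_normalTowerLimitHom hgen hproj)
      (QuotientGroup.mk'_surjective (perfectCore _)))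
  exact hprod.nilpotencyClass_right_le.trans <|
    Nat.succ_le_succ (Group.nilpotencyClass_le_of_surjective q hq)

theorem mainTheorem8 {Γ G : Type u} [Group Γ] [Group G] [Finite Γ] [Finite G] (φ : Γ →* G)
    (hperf : Group.IsPerfect G)
    (hgen : Subgroup.normalClosure (Set.range φ) = ⊤) :
    -- the three series involved terminate, so that their last terms make sense
    TerminatesAt (derivedSeries (normalTowerLimit φ)) (perfectCore (normalTowerLimit φ)) ∧
    TerminatesAt (Subgroup.upperCentralSeries (normalTowerLimit φ))
      (hypercenter (normalTowerLimit φ)) ∧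
    TerminatesAt (Subgroup.lowerCentralSeries (⊤ : Subgroup Γ)) (gammaInfty Γ) ∧
    Group.IsPerfect (perfectCore (normalTowerLimit φ)) ∧
    IsCentralProduct (perfectCore (normalTowerLimit φ)) (hypercenter (normalTowerLimit φ)) ∧
    Group.IsNilpotent (Γ ⧸ gammaInfty Γ) ∧
    Group.IsNilpotent (hypercenter (normalTowerLimit φ)) ∧
    ∀ c : ℕ, Group.nilpotencyClass (Γ ⧸ gammaInfty Γ) = c →
      Group.nilpotencyClass (hypercenter (normalTowerLimit φ)) ≤ c + 1 :=
  mainTheorem8_general φ hperf hgen
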